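/- Let $\alpha>1$ and $m_\alpha>m_1^\alpha$ with $m_1>0$ be real numbers, and let $\mathcal F_{1,\alpha}$ be the set of all Borel probability measures $F$ on $[0,\infty)$ with $\int w\,dF(w)=m_1$ and $\int w^\alpha\,dF(w)=m_\alpha$. For a critical ratio $\eta\in(0,1)$ the distributionally robust newsvendor problem is $$\min_{q\ge 0}\Big((1-\eta)q+\sup_{F\in\mathcal F_{1,\alpha}}\mathbb E_F[\tilde d-q]_+\Big),$$ and the standard newsvendor problem with demand distribution $F$ is $\min_{q\ge0}\big((1-\eta)q+\mathbb E_F[\tilde d-q]_+\big)$. There is a probability distribution $F^*$ on $[0,\infty)$, not belonging to $\mathcal F_{1,\alpha}$, such that (i) $\mathbb E_{F^*}[\tilde d^*-q]_+=\sup_{F\in\mathcal F_{1,\alpha}}\mathbb E_F[\tilde d-q]_+$ for all $q\ge0$; (ii) its tail $\overline F^*=1-F^*$ is regularly varying at infinity with index $-\alpha$, that is, $\overline F^*(tx)/\overline F^*(x)\to t^{-\alpha}$ as $x\to\infty$, for every $t>0$; (iii) $\mathbb E_{F^*}[(\tilde d^*)^{p}]<\infty$ for $0\le p<\alpha$ and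 $\mathbb E_{F^*}[(\tilde d^*)^{p}]=\infty$ for $p\ge\alpha$. For every $\eta\in(0,1)$ the distributionally robust newsvendor problem has an optimal order quantity, and, for every $F^*$ as above, each such optimal order quantity is also optimal for the standard newsvendor problem with demand distribution $F^*$ and critical ratio $\eta$. Moreover, if for each $\eta\in(0,1)$, $q^*_\eta$ is any optimal order quantity and $C^*_\eta$ is the optimal cost of the distributionally robust newsvendor problem, then $$q^*_\eta\sim\frac{\alpha-1}{\alpha}\,\frac{1}{1-\eta}\,C^*_\eta\qquad\text{as }\eta\uparrow1 .$$ -/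

import Mathlib

open MeasureTheory Set Filter Topology Asymptotics

noncomputable section

namespace Newsvendor

/-- A distribution of a nonnegative random demand: a Borel probability measure on `ℝ` which
gives no mass to the negative half-line. -/
structure IsDemandDistribution (F : Measure ℝ) : Prop where
  isProbabilityMeasure : IsProbabilityMeasure F
  nonneg : F (Iio 0) = 0

/-- The moment ambiguity set: all demand distributions with first moment `m₁` and
`α`th moment `mα`. -/
def ambiguitySet (α m₁ mα : ℝ) : Set (Measure ℝ) :=
  {F | IsDemandDistribution F ∧
    (Integrable (fun w : ℝ => w) F ∧ ∫ w, w ∂F = m₁) ∧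
    (Integrable (fun w : ℝ => w ^ α) F ∧ ∫ w, w ^ α ∂F = mα)}

/-- The expected lost sales `E_F[d - q]₊` for the demand distribution `F`. -/
def expectedShortage (F : Measure ℝ) (q : ℝ) : ℝ := ∫ w, max (w - q) 0 ∂F

/-- The worst-case expected lost sales `sup_{F ∈ 𝓕} E_F[d - q]₊`. -/
def worstCaseShortage (𝓕 : Set (Measure ℝ)) (q : ℝ) : ℝ :=
  sSup ((fun F => expectedShortage F q) '' 𝓕)

/-- The cost `(1 - η) q + E_F[d - q]₊` of the standard newsvendor problem with demand
distribution `F` and critical ratio `η`. -/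
def cost (F : Measure ℝ) (η q : ℝ) : ℝ := (1 - η) * q + expectedShortage F q

/-- `q` is an optimal order quantity of the standard newsvendor problem `min_{q ≥ 0} cost F η q`. -/
def IsOptimal (F : Measure ℝ) (η q : ℝ) : Prop :=
  q ∈ Ici (0 : ℝ) ∧ IsMinOn (cost F η) (Ici 0) q

/-- The cost `(1 - η) q + sup_{F ∈ 𝓕} E_F[d - q]₊` of the distributionally robust newsvendor
problem. -/
def robustCost (𝓕 : Set (Measure ℝ)) (η q : ℝ) : ℝ := (1 - η) * q + worstCaseShortage 𝓕 q

/-- `q` is an optimal order quantity of the distributionally robust newsvendor problem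
`min_{q ≥ 0} robustCost 𝓕 η q`. -/
def IsRobustOptimal (𝓕 : Set (Measure ℝ)) (η q : ℝ) : Prop :=
  q ∈ Ici (0 : ℝ) ∧ IsMinOn (robustCost 𝓕 η) (Ici 0) q

/-- The optimal worst-case cost of the distributionally robust newsvendor problem. -/
def optimalRobustCost (𝓕 : Set (Measure ℝ)) (η : ℝ) : ℝ :=
  sInf (robustCost 𝓕 η '' Ici 0)

/-- `u` is regularly varying at infinity with index `ρ`. -/
def IsRegularlyVarying (u : ℝ → ℝ) (ρ : ℝ) : Prop :=
  ∀ t : ℝ, 0 < t → Tendsto (fun x => u (t * x) / u x) atTop (𝓝 (t ^ ρ))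

/-- The tail function `x ↦ P(d > x)` of the distribution `F`. -/
def tail (F : Measure ℝ) (x : ℝ) : ℝ := F.real (Ioi x)

/-- The expectation `E_F[d ^ p] ∈ [0, ∞]`, for a demand distribution `F`. -/
def moment (F : Measure ℝ) (p : ℝ) : ENNReal := ∫⁻ w, ENNReal.ofReal (w ^ p) ∂F

/-- `Fstar` is a heavy-tailed demand distribution, outside the ambiguity set, which reproduces the
worst-case expected lost sales over the ambiguity set at every order quantity. -/
structure IsHeavyTailedEquivalent (α m₁ mα : ℝ) (Fstar : Measure ℝ) : Prop where
  isDemandDistribution : IsDemandDistribution Fstar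
  notMem : Fstar ∉ ambiguitySet α m₁ mα
  shortage_eq : ∀ q : ℝ, 0 ≤ q →
    expectedShortage Fstar q = worstCaseShortage (ambiguitySet α m₁ mα) q
  tail_regularlyVarying : IsRegularlyVarying (tail Fstar) (-α)
  moment_lt_top : ∀ p : ℝ, 0 ≤ p → p < α → moment Fstar p < ⊤
  moment_eq_top : ∀ p : ℝ, α ≤ p → moment Fstar p = ⊤

end Newsvendor

end

namespace Newsvendor

variable {α m₁ mα : ℝ} {F : Measure ℝ}

/-! Let W(q) be the worst-case shortage. As a supremum of expected shortages it is convex and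
nonincreasing, and W(q) = m₁ - q for q ≤ 0. A multiple of the gap between w ^ α and its tangent at
m₁ majorises (w - q)₊ and bounds W above; two-point laws bound it below. The bounds agree to leading
order, so W(q) ~ K q ^ (1 - α). In particular W vanishes at infinity, hence 1 + W' (right
derivative) is the distribution function of a law with shortage W
(`exists_isDemandDistribution_of_convexOn`).

Both remaining limits use one device, `tendsto_of_forall_mul_le`: compare q with t q, use W(t q) /
W(q) → t ^ (1 - α), and let t → 1. Bounding shortage differences by the tail gives q P(d > q) / W(q)
→ α - 1, whence the tail is ~ (α - 1) K q ^ (-α); regular variation and the moments follow.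
Optimality of q gives (1 - η) q / W(q) → α - 1, and the optimal cost C is (1 - η) q + W(q), so (1 -
η) q / C → (α - 1) / α. -/

/-! ### Expected shortage of a single distribution -/

theorem IsDemandDistribution.ae_nonneg (hF : IsDemandDistribution F) : ∀ᵐ w ∂F, 0 ≤ w := by
  rw [ae_iff]
  simpa [not_le, Iio] using hF.nonneg

theorem integrable_max_sub [IsFiniteMeasure F] (hi : Integrable (fun w : ℝ => w) F) (q : ℝ) :
    Integrable (fun w : ℝ => max (w - q) 0) F :=
  (hi.sub (integrable_const q)).pos_part

theorem expectedShortage_nonneg (F : Measure ℝ) (q : ℝ) : 0 ≤ expectedShortage F q :=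
  integral_nonneg fun _ => le_max_right _ _

theorem expectedShortage_anti [IsFiniteMeasure F] (hi : Integrable (fun w : ℝ => w) F)
    {a b : ℝ} (hab : a ≤ b) : expectedShortage F b ≤ expectedShortage F a :=
  integral_mono (integrable_max_sub hi b) (integrable_max_sub hi a) fun w =>
    max_le_max (by linarith) le_rfl

theorem expectedShortage_convex [IsFiniteMeasure F] (hi : Integrable (fun w : ℝ => w) F)
    {x y a b : ℝ} (ha : 0 ≤ a) (hb : 0 ≤ b) (hab : a + b = 1) :
    expectedShortage F (a * x + b * y) ≤ a * expectedShortage F x + b * expectedShortage F y := by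
  unfold expectedShortage
  have h1 := (integrable_max_sub hi x).const_mul a
  have h2 := (integrable_max_sub hi y).const_mul b
  rw [← integral_const_mul, ← integral_const_mul, ← integral_add h1 h2]
  refine integral_mono (integrable_max_sub hi _) (h1.add h2) fun w => ?_
  have e : w - (a * x + b * y) = a * (w - x) + b * (w - y) := by linear_combination -w * hab
  have hx := mul_le_mul_of_nonneg_left (le_max_left (w - x) 0) ha
  have hy := mul_le_mul_of_nonneg_left (le_max_left (w - y) 0) hb
  have hx' := mul_nonneg ha (le_max_right (w - x) 0)
  have hy' := mul_nonneg hb (le_max_right (w - y) 0)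
  exact max_le (by simp only; linarith) (add_nonneg hx' hy')

theorem expectedShortage_of_nonpos (hF : IsDemandDistribution F)
    (hi : Integrable (fun w : ℝ => w) F) {q : ℝ} (hq : q ≤ 0) :
    expectedShortage F q = ∫ w, w ∂F - q := by
  have := hF.isProbabilityMeasure
  unfold expectedShortage
  rw [integral_congr_ae (g := fun w => w - q), integral_sub hi (integrable_const q)]
  · simp
  · filter_upwards [hF.ae_nonneg] with w hw
    exact max_eq_left (by linarith)

/-- The difference of the expected shortages at two order quantities is controlled by the tail. -/
theorem tail_mul_le [IsFiniteMeasure F] (hi : Integrable (fun w : ℝ => w) F) {a b : ℝ}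
    (hab : a ≤ b) : (b - a) * tail F b ≤ expectedShortage F a - expectedShortage F b := by
  unfold expectedShortage tail
  rw [← integral_sub (integrable_max_sub hi a) (integrable_max_sub hi b), mul_comm, ← smul_eq_mul,
    ← integral_indicator_const _ measurableSet_Ioi]
  refine integral_mono ((integrable_const _).indicator measurableSet_Ioi)
    ((integrable_max_sub hi a).sub (integrable_max_sub hi b)) fun w => ?_
  by_cases hw : w ∈ Ioi b
  · have hw' : b < w := hw
    simp only [indicator_of_mem hw]
    rw [max_eq_left (by linarith), max_eq_left (by linarith)]
    linarith
  · simp only [indicator_of_notMem hw]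
    exact sub_nonneg.2 (max_le_max (by linarith) le_rfl)

theorem le_tail_mul [IsFiniteMeasure F] (hi : Integrable (fun w : ℝ => w) F) {a b : ℝ}
    (hab : a ≤ b) : expectedShortage F a - expectedShortage F b ≤ (b - a) * tail F a := by
  unfold expectedShortage tail
  rw [← integral_sub (integrable_max_sub hi a) (integrable_max_sub hi b), mul_comm, ← smul_eq_mul,
    ← integral_indicator_const _ measurableSet_Ioi]
  refine integral_mono ((integrable_max_sub hi a).sub (integrable_max_sub hi b))
    ((integrable_const _).indicator measurableSet_Ioi) fun w => ?_
  by_cases hw : w ∈ Ioi a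
  · have hw' : a < w := hw
    simp only [indicator_of_mem hw]
    rw [max_eq_left (by linarith : (0 : ℝ) ≤ w - a)]
    linarith [le_max_left (w - b) 0]
  · have hw' : w ≤ a := not_lt.1 hw
    simp only [indicator_of_notMem hw]
    rw [max_eq_right (by linarith), max_eq_right (by linarith)]
    simp

/-! ### Dual upper bound and two-point lower bound -/

/-- The tangent line inequality for the power function. -/
theorem rpow_tangent_le (hα : 1 ≤ α) {y w : ℝ} (hy : 0 < y) (hw : 0 ≤ w) :
    y ^ α + α * y ^ (α - 1) * (w - y) ≤ w ^ α := by
  have h := one_add_mul_self_le_rpow_one_add (s := w / y - 1)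
    (by linarith [div_nonneg hw hy.le]) hα
  rw [add_sub_cancel, Real.div_rpow hw hy.le, le_div_iff₀ (Real.rpow_pos_of_pos hy α)] at h
  have e : y ^ α = y ^ (α - 1) * y := by
    rw [← Real.rpow_add_one hy.ne', sub_add_cancel]
  refine le_trans (le_of_eq ?_) h
  rw [e]
  field_simp

/-- Weak duality: the gap between w ^ α and its tangent at m₁, scaled to have slope 1 at y,
dominates (w - q)₊, and its integral is fixed by the two moments. The condition on q and y places
its tangent at y above w - q; it is slightly stronger than needed, a term in m₁ ^ α being dropped.
-/
theorem expectedShortage_le (hα : 1 < α) (hm₁ : 0 < m₁) (hF : F ∈ ambiguitySet α m₁ mα) {q y : ℝ}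
    (hy : m₁ < y)
    (hqy : (α - 1) * y ^ α ≤ α * q * (y ^ (α - 1) - m₁ ^ (α - 1))) :
    expectedShortage F q ≤ (mα - m₁ ^ α) / (α * (y ^ (α - 1) - m₁ ^ (α - 1))) := by
  obtain ⟨hd, ⟨hi, h1⟩, hiα, hα'⟩ := hF
  have := hd.isProbabilityMeasure
  have hD : 0 < y ^ (α - 1) - m₁ ^ (α - 1) :=
    sub_pos.2 (Real.rpow_lt_rpow hm₁.le hy (by linarith))
  have hαD : 0 < α * (y ^ (α - 1) - m₁ ^ (α - 1)) := by positivity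
  have e (z : ℝ) (hz : 0 < z) : z ^ α = z ^ (α - 1) * z := by
    rw [← Real.rpow_add_one hz.ne', sub_add_cancel]
  have hm : 0 < m₁ ^ α := Real.rpow_pos_of_pos hm₁ α
  have i1 : Integrable (fun w : ℝ => w ^ α - m₁ ^ α) F := hiα.sub (integrable_const _)
  have i2 : Integrable (fun w : ℝ => α * m₁ ^ (α - 1) * (w - m₁)) F :=
    (hi.sub (integrable_const _)).const_mul _
  have hint : ∫ w, (w ^ α - m₁ ^ α - α * m₁ ^ (α - 1) * (w - m₁)) ∂F = mα - m₁ ^ α := by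
    rw [integral_sub i1 i2, integral_sub hiα (integrable_const _),
      integral_const_mul, integral_sub hi (integrable_const _), h1, hα']
    simp
  rw [← hint, div_eq_inv_mul, ← integral_const_mul]
  refine integral_mono_ae (integrable_max_sub hi q) ((i1.sub i2).const_mul _) ?_
  filter_upwards [hd.ae_nonneg] with w hw
  have t1 := rpow_tangent_le hα.le hm₁ hw
  have t2 := rpow_tangent_le hα.le (hm₁.trans hy) hw
  rw [← div_eq_inv_mul, le_div_iff₀ hαD]
  -- Below q the tangent at m₁ suffices; above q the tangent at y is needed.
  rcases le_total (w - q) 0 with h | h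
  · rw [max_eq_right h]
    linarith
  · rw [max_eq_left h]
    have e1 := e y (hm₁.trans hy)
    have e2 := e m₁ hm₁
    have h3 : 0 ≤ (α - 1) * m₁ ^ α := mul_nonneg (by linarith) hm.le
    nlinarith

/-- The law sits on y and some x in [0, m₁], with weights set by the mean. As x falls from m₁ to 0
its α-moment moves continuously from m₁ ^ α to m₁ y ^ (α - 1), so some x gives mα. -/
theorem exists_mem_ambiguitySet (hα : 1 < α) (hm₁ : 0 < m₁) (hmα : m₁ ^ α < mα) {y : ℝ}
    (hy : m₁ < y) (hy' : mα ≤ m₁ * y ^ (α - 1)) :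
    ∃ F ∈ ambiguitySet α m₁ mα, ∀ q ≤ y,
      (mα - m₁ ^ α) * y ^ (-α) * (y - q) ≤ expectedShortage F q := by
  have hy0 : 0 < y := hm₁.trans hy
  have hyα : 0 < y ^ α := Real.rpow_pos_of_pos hy0 α
  have e : y ^ α = y ^ (α - 1) * y := by
    rw [← Real.rpow_add_one hy0.ne', sub_add_cancel]
  have hcont : ContinuousOn (fun x : ℝ => ((y - m₁) * x ^ α + (m₁ - x) * y ^ α) / (y - x))
      (Icc 0 m₁) := by
    refine ContinuousOn.div ?_ (by fun_prop) fun x hx => by linarith [hx.2]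
    exact (continuousOn_const.mul
      (Real.continuous_rpow_const (by linarith)).continuousOn).add (by fun_prop)
  obtain ⟨x, hx, hxe⟩ := intermediate_value_Icc' hm₁.le hcont
    (show mα ∈ Icc _ _ from ⟨by
      simp only [sub_self, zero_mul, add_zero]
      rw [mul_div_cancel_left₀ _ (by linarith)]
      exact hmα.le, by
      simp only [Real.zero_rpow (by linarith : α ≠ 0), mul_zero, zero_add, sub_zero]
      rw [e, ← mul_assoc, mul_div_cancel_right₀ _ hy0.ne']
      exact hy'⟩)
  have hyx : 0 < y - x := by linarith [hx.2]
  set p : ℝ := (m₁ - x) / (y - x) with hp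
  have hp0 : 0 ≤ p := div_nonneg (by linarith [hx.2]) hyx.le
  have hp1 : p ≤ 1 := (div_le_one hyx).2 (by linarith)
  have hpx : p * (y - x) = m₁ - x := div_mul_cancel₀ _ hyx.ne'
  have hpα : (1 - p) * x ^ α + p * y ^ α = mα := by
    rw [← hxe, hp]
    field_simp
    ring
  set F : Measure ℝ := ENNReal.ofReal (1 - p) • Measure.dirac x + ENNReal.ofReal p • Measure.dirac y
    with hFdef
  have hint (f : ℝ → ℝ) : Integrable f F ∧ ∫ w, f w ∂F = (1 - p) * f x + p * f y := by
    have i1 : Integrable f (ENNReal.ofReal (1 - p) • Measure.dirac x) :=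
      (integrable_dirac (by simp)).smul_measure ENNReal.ofReal_ne_top
    have i2 : Integrable f (ENNReal.ofReal p • Measure.dirac y) :=
      (integrable_dirac (by simp)).smul_measure ENNReal.ofReal_ne_top
    refine ⟨i1.add_measure i2, ?_⟩
    rw [integral_add_measure i1 i2, integral_smul_measure, integral_smul_measure, integral_dirac,
      integral_dirac, ENNReal.toReal_ofReal (by linarith), ENNReal.toReal_ofReal hp0]
    simp
  refine ⟨F, ⟨⟨⟨?_⟩, ?_⟩, ⟨(hint _).1, ?_⟩, (hint _).1, ?_⟩, fun q hq => ?_⟩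
  · simp [hFdef, ← ENNReal.ofReal_add (by linarith : 0 ≤ 1 - p) hp0]
  · simp [hFdef, hx.1, hy0.le]
  · rw [(hint _).2]
    linarith
  · rw [(hint _).2, hpα]
  · unfold expectedShortage
    rw [(hint _).2, max_eq_left (by linarith : (0 : ℝ) ≤ y - q)]
    have h1 : 0 ≤ (1 - p) * max (x - q) 0 := mul_nonneg (by linarith) (le_max_right _ _)
    have h2 : x ^ α ≤ m₁ ^ α := Real.rpow_le_rpow hx.1 hx.2 (by linarith)
    have h3 : 0 ≤ x ^ α := Real.rpow_nonneg hx.1 α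
    -- The atom at y carries p y ^ α = mα - (1 - p) x ^ α ≥ mα - m₁ ^ α.
    have h4 : (mα - m₁ ^ α) * y ^ (-α) ≤ p := by
      rw [Real.rpow_neg hy0.le, ← div_eq_mul_inv, div_le_iff₀ hyα]
      nlinarith
    nlinarith [mul_le_mul_of_nonneg_right h4 (by linarith : (0 : ℝ) ≤ y - q)]

/-! ### The worst-case shortage as a function of the order quantity -/

theorem ambiguitySet_nonempty (hα : 1 < α) (hm₁ : 0 < m₁) (hmα : m₁ ^ α < mα) :
    (ambiguitySet α m₁ mα).Nonempty := by
  obtain ⟨y, hy, hy'⟩ := ((eventually_gt_atTop m₁).and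
    (((tendsto_rpow_atTop (by linarith : 0 < α - 1)).const_mul_atTop hm₁).eventually_ge_atTop
      mα)).exists
  obtain ⟨F, hF, -⟩ := exists_mem_ambiguitySet hα hm₁ hmα hy hy'
  exact ⟨F, hF⟩

/-- Needed because `sSup` of an unbounded set of reals is 0. At -|q| ≤ q every shortage equals m₁ +
|q|. -/
theorem bddAbove_expectedShortage (q : ℝ) :
    BddAbove ((fun F => expectedShortage F q) '' ambiguitySet α m₁ mα) := by
  refine ⟨m₁ + |q|, ?_⟩
  rintro _ ⟨F, ⟨hd, ⟨hi, h1⟩, -⟩, rfl⟩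
  have := hd.isProbabilityMeasure
  refine (expectedShortage_anti hi (neg_abs_le q)).trans ?_
  rw [expectedShortage_of_nonpos hd hi (by simp), h1, sub_neg_eq_add]

theorem expectedShortage_le_worstCaseShortage (hF : F ∈ ambiguitySet α m₁ mα) (q : ℝ) :
    expectedShortage F q ≤ worstCaseShortage (ambiguitySet α m₁ mα) q :=
  le_csSup (bddAbove_expectedShortage q) (mem_image_of_mem _ hF)

theorem worstCaseShortage_le (hne : (ambiguitySet α m₁ mα).Nonempty) {q c : ℝ}
    (h : ∀ F ∈ ambiguitySet α m₁ mα, expectedShortage F q ≤ c) :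
    worstCaseShortage (ambiguitySet α m₁ mα) q ≤ c :=
  csSup_le (hne.image _) (by rintro _ ⟨F, hF, rfl⟩; exact h F hF)

theorem worstCaseShortage_nonneg (q : ℝ) : 0 ≤ worstCaseShortage (ambiguitySet α m₁ mα) q :=
  Real.sSup_nonneg (by rintro _ ⟨F, -, rfl⟩; exact expectedShortage_nonneg F q)

theorem worstCaseShortage_antitone (hne : (ambiguitySet α m₁ mα).Nonempty) :
    Antitone (worstCaseShortage (ambiguitySet α m₁ mα)) := fun _ _ hab =>
  worstCaseShortage_le hne fun _ hF =>
    have := hF.1.isProbabilityMeasure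
    (expectedShortage_anti hF.2.1.1 hab).trans (expectedShortage_le_worstCaseShortage hF _)

theorem worstCaseShortage_convexOn (hne : (ambiguitySet α m₁ mα).Nonempty) :
    ConvexOn ℝ univ (worstCaseShortage (ambiguitySet α m₁ mα)) :=
  ⟨convex_univ, fun _ _ _ _ _ _ ha hb hab => worstCaseShortage_le hne fun _ hF =>
    have := hF.1.isProbabilityMeasure
    (expectedShortage_convex hF.2.1.1 ha hb hab).trans (add_le_add
      (mul_le_mul_of_nonneg_left (expectedShortage_le_worstCaseShortage hF _) ha)
      (mul_le_mul_of_nonneg_left (expectedShortage_le_worstCaseShortage hF _) hb))⟩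

theorem worstCaseShortage_of_nonpos (hne : (ambiguitySet α m₁ mα).Nonempty) {q : ℝ} (hq : q ≤ 0) :
    worstCaseShortage (ambiguitySet α m₁ mα) q = m₁ - q := by
  have h (F) (hF : F ∈ ambiguitySet α m₁ mα) : expectedShortage F q = m₁ - q := by
    rw [expectedShortage_of_nonpos hF.1 hF.2.1.1 hq, hF.2.1.2]
  refine le_antisymm (worstCaseShortage_le hne fun F hF => (h F hF).le) ?_
  obtain ⟨F, hF⟩ := hne
  exact (h F hF).symm.le.trans (expectedShortage_le_worstCaseShortage hF q)

/-! ### Asymptotics of the worst-case shortage -/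

/-- The limit of `q ^ (α - 1)` times the worst-case expected lost sales. -/
noncomputable def shortageConst (α m₁ mα : ℝ) : ℝ :=
  (mα - m₁ ^ α) * (α / (α - 1)) ^ (-α) / (α - 1)

theorem shortageConst_pos (hα : 1 < α) (hmα : m₁ ^ α < mα) : 0 < shortageConst α m₁ mα := by
  have h1 : 0 < α - 1 := by linarith
  have h2 : 0 < mα - m₁ ^ α := by linarith
  have h3 : 0 < (α / (α - 1)) ^ (-α) := Real.rpow_pos_of_pos (by positivity) _
  unfold shortageConst
  positivity

/-- The two-point law is used with y = α q / (α - 1), which maximises y ^ (-α) (y - q). -/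
theorem eventually_shortageConst_le (hα : 1 < α) (hm₁ : 0 < m₁) (hmα : m₁ ^ α < mα) :
    ∀ᶠ q in atTop, shortageConst α m₁ mα ≤
      worstCaseShortage (ambiguitySet α m₁ mα) q * q ^ (α - 1) := by
  have h1 : 0 < α - 1 := by linarith
  have hβ : 0 < α / (α - 1) := by positivity
  have ht : Tendsto (fun q : ℝ => α / (α - 1) * q) atTop atTop := tendsto_id.const_mul_atTop hβ
  filter_upwards [eventually_gt_atTop 0, ht.eventually (eventually_gt_atTop m₁), ht.eventually
    (((tendsto_rpow_atTop h1).const_mul_atTop hm₁).eventually_ge_atTop mα)] with q hq hy hy'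
  obtain ⟨F, hF, hFq⟩ := exists_mem_ambiguitySet hα hm₁ hmα hy hy'
  have e : α / (α - 1) * q - q = q / (α - 1) := by field_simp; ring
  have h := (hFq q (by linarith [div_pos hq h1])).trans (expectedShortage_le_worstCaseShortage hF q)
  refine le_trans (le_of_eq ?_) (mul_le_mul_of_nonneg_right h (Real.rpow_pos_of_pos hq _).le)
  rw [e, Real.mul_rpow hβ.le hq.le, Real.rpow_sub_one hq.ne', Real.rpow_neg hq.le]
  unfold shortageConst
  have := (Real.rpow_pos_of_pos hq α).ne'
  field_simp

theorem eventually_worstCaseShortage_le (hα : 1 < α) (hm₁ : 0 < m₁) (hmα : m₁ ^ α < mα) :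
    ∀ᶠ q in atTop, worstCaseShortage (ambiguitySet α m₁ mα) q * q ^ (α - 1) ≤
      (mα - m₁ ^ α) / (α * ((α / (α - 1) * (1 - (2 * m₁ / q) ^ (α - 1))) ^ (α - 1) -
        (m₁ / q) ^ (α - 1))) := by
  have h1 : 0 < α - 1 := by linarith
  have hβ : 1 ≤ α / (α - 1) := (one_le_div h1).2 (by linarith)
  have ht : Tendsto (fun q : ℝ => (2 * m₁ / q) ^ (α - 1)) atTop (𝓝 0) := by
    have := (tendsto_const_nhds (x := 2 * m₁)).div_atTop tendsto_id |>.rpow_const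
      (p := α - 1) (Or.inr h1.le)
    rwa [Real.zero_rpow h1.ne'] at this
  filter_upwards [eventually_gt_atTop 0, eventually_gt_atTop (2 * m₁),
    ht.eventually (gt_mem_nhds (by norm_num : (0 : ℝ) < 1 / 2))] with q hq hqm hθ
  -- The dual condition reads (α - 1) y ≤ α q (1 - (m₁ / y) ^ (α - 1)). As y = b q will be at least
  -- q / 2, θ dominates the subtracted power, and this b then satisfies the condition.
  set θ : ℝ := (2 * m₁ / q) ^ (α - 1)
  set b : ℝ := α / (α - 1) * (1 - θ) with hb
  have hb2 : 1 / 2 ≤ b := by nlinarith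
  have hbq : q / 2 ≤ b * q := by nlinarith
  have hy : m₁ < b * q := by linarith
  have hq' : 0 < q ^ (α - 1) := Real.rpow_pos_of_pos hq _
  have hyp : 0 < (b * q) ^ (α - 1) := Real.rpow_pos_of_pos (by linarith) _
  have hθy : m₁ ^ (α - 1) ≤ θ * (b * q) ^ (α - 1) := by
    rw [← Real.mul_rpow (by positivity) (by linarith)]
    refine Real.rpow_le_rpow hm₁.le ?_ h1.le
    have : 2 * m₁ / q * (b * q) = 2 * b * m₁ := by field_simp
    nlinarith
  have e : (b * q) ^ α = (b * q) ^ (α - 1) * (b * q) := by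
    rw [← Real.rpow_add_one (by linarith), sub_add_cancel]
  have hcond : (α - 1) * (b * q) ^ α ≤ α * q * ((b * q) ^ (α - 1) - m₁ ^ (α - 1)) := by
    have : (α - 1) * (b * q) ^ α = α * q * ((b * q) ^ (α - 1) - θ * (b * q) ^ (α - 1)) := by
      rw [e, hb]
      field_simp
    rw [this]
    exact mul_le_mul_of_nonneg_left (by linarith) (by positivity)
  have h := worstCaseShortage_le (ambiguitySet_nonempty hα hm₁ hmα)
    fun F hF => expectedShortage_le hα hm₁ hF hy hcond
  refine (mul_le_mul_of_nonneg_right h hq'.le).trans (le_of_eq ?_)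
  have hD : 0 < b ^ (α - 1) * q ^ (α - 1) - m₁ ^ (α - 1) := by
    rw [← Real.mul_rpow (by linarith) hq.le]
    exact sub_pos.2 (Real.rpow_lt_rpow hm₁.le hy h1)
  rw [Real.mul_rpow (by linarith) hq.le, Real.div_rpow hm₁.le hq.le]
  have e2 : b ^ (α - 1) - m₁ ^ (α - 1) / q ^ (α - 1) =
      (b ^ (α - 1) * q ^ (α - 1) - m₁ ^ (α - 1)) / q ^ (α - 1) := by field_simp
  rw [e2]
  field_simp

theorem tendsto_worstCaseShortage_mul_rpow (hα : 1 < α) (hm₁ : 0 < m₁) (hmα : m₁ ^ α < mα) :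
    Tendsto (fun q => worstCaseShortage (ambiguitySet α m₁ mα) q * q ^ (α - 1)) atTop
      (𝓝 (shortageConst α m₁ mα)) := by
  have h1 : 0 < α - 1 := by linarith
  have hβ : 0 < α / (α - 1) := by positivity
  have ht (c : ℝ) : Tendsto (fun q : ℝ => (c / q) ^ (α - 1)) atTop (𝓝 0) := by
    have := (tendsto_const_nhds (x := c)).div_atTop tendsto_id |>.rpow_const
      (p := α - 1) (Or.inr h1.le)
    rwa [Real.zero_rpow h1.ne'] at this
  refine tendsto_of_tendsto_of_tendsto_of_le_of_le' tendsto_const_nhds ?_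
    (eventually_shortageConst_le hα hm₁ hmα) (eventually_worstCaseShortage_le hα hm₁ hmα)
  have hpow : 0 < (α / (α - 1)) ^ (α - 1) := Real.rpow_pos_of_pos hβ _
  have e : shortageConst α m₁ mα = (mα - m₁ ^ α) /
      (α * ((α / (α - 1) * (1 - 0)) ^ (α - 1) - 0)) := by
    have : (α / (α - 1)) ^ (-α) = ((α / (α - 1)) ^ (α - 1) * (α / (α - 1)))⁻¹ := by
      rw [← Real.rpow_add_one hβ.ne', sub_add_cancel, Real.rpow_neg hβ.le]
    rw [shortageConst, this, sub_zero, sub_zero, mul_one]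
    field_simp
  rw [e]
  refine tendsto_const_nhds.div (((((ht _).const_sub 1).const_mul _).rpow_const
    (Or.inr h1.le)).sub (ht _) |>.const_mul α) ?_
  simp only [sub_zero, mul_one]
  positivity

theorem tendsto_worstCaseShortage (hα : 1 < α) (hm₁ : 0 < m₁) (hmα : m₁ ^ α < mα) :
    Tendsto (worstCaseShortage (ambiguitySet α m₁ mα)) atTop (𝓝 0) := by
  have h := (tendsto_worstCaseShortage_mul_rpow hα hm₁ hmα).mul
    (tendsto_rpow_neg_atTop (by linarith : 0 < α - 1))
  rw [mul_zero] at h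
  refine h.congr' ?_
  filter_upwards [eventually_gt_atTop 0] with q hq
  rw [Real.rpow_neg hq.le, mul_assoc, mul_inv_cancel₀ (Real.rpow_pos_of_pos hq _).ne', mul_one]

theorem worstCaseShortage_pos (hα : 1 < α) (hm₁ : 0 < m₁) (hmα : m₁ ^ α < mα) (q : ℝ) :
    0 < worstCaseShortage (ambiguitySet α m₁ mα) q := by
  obtain ⟨r, hr, hr0, hqr⟩ := ((eventually_shortageConst_le hα hm₁ hmα).and
    ((eventually_gt_atTop 0).and (eventually_ge_atTop q))).exists
  refine lt_of_lt_of_le ?_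
    (worstCaseShortage_antitone (ambiguitySet_nonempty hα hm₁ hmα) hqr)
  exact pos_of_mul_pos_left ((shortageConst_pos hα hmα).trans_le hr)
    (Real.rpow_pos_of_pos hr0 _).le

theorem tendsto_worstCaseShortage_ratio (hα : 1 < α) (hm₁ : 0 < m₁) (hmα : m₁ ^ α < mα) {t : ℝ}
    (ht : 0 < t) :
    Tendsto (fun q => worstCaseShortage (ambiguitySet α m₁ mα) (t * q) /
      worstCaseShortage (ambiguitySet α m₁ mα) q) atTop (𝓝 (t ^ (1 - α))) := by
  have h := tendsto_worstCaseShortage_mul_rpow hα hm₁ hmα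
  have hK := (shortageConst_pos hα hmα).ne'
  have h2 := ((h.comp (tendsto_id.const_mul_atTop ht)).div h hK).mul_const (t ^ (1 - α))
  rw [div_self hK, one_mul] at h2
  refine h2.congr' ?_
  filter_upwards [eventually_gt_atTop 0] with q hq
  have hq' := (Real.rpow_pos_of_pos hq (α - 1)).ne'
  have ht' := (Real.rpow_pos_of_pos ht (α - 1)).ne'
  have := (worstCaseShortage_pos hα hm₁ hmα q).ne'
  have e : t ^ (1 - α) = (t ^ (α - 1))⁻¹ := by rw [← Real.rpow_neg ht.le, neg_sub]
  simp only [Pi.div_apply, Function.comp_apply, id]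
  rw [Real.mul_rpow ht.le hq.le, e]
  field_simp

/-! ### Convex functions as expected shortages -/

/-- A convex function on the line which vanishes at `+∞` and has slope `-1` on the negative
half-line is the expected shortage of a demand distribution. -/
theorem exists_isDemandDistribution_of_convexOn {f : ℝ → ℝ} {m : ℝ} (hf : ConvexOn ℝ univ f)
    (hanti : Antitone f) (htop : Tendsto f atTop (𝓝 0)) (hneg : ∀ q ≤ 0, f q = m - q) :
    ∃ F : Measure ℝ, IsDemandDistribution F ∧
      ∀ q, ∫⁻ w, ENNReal.ofReal (max (w - q) 0) ∂F = ENNReal.ofReal (f q) := by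
  set g : ℝ → ℝ := fun x => derivWithin f (Ioi x) x with hg
  have hder (x : ℝ) : HasDerivWithinAt f (g x) (Ioi x) x :=
    hf.hasDerivWithinAt_rightDeriv_of_mem_interior (by simp)
  have hmono : Monotone g := by
    have := hf.monotoneOn_rightDeriv
    rwa [interior_univ, monotoneOn_univ] at this
  have hle {x y : ℝ} (hxy : x < y) : g x ≤ (f y - f x) / (y - x) := by
    rw [← slope_def_field]
    exact hf.le_slope_of_hasDerivWithinAt_Ioi (mem_univ _) (mem_univ _) hxy (hder x)
  have hge {x y : ℝ} (hxy : x < y) : (f y - f x) / (y - x) ≤ g y := by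
    rw [← slope_def_field]
    exact (hf.slope_le_of_hasDerivWithinAt_Iio (mem_univ _) (mem_univ _) hxy
      (hf.hasDerivWithinAt_leftDeriv_of_mem_interior (by simp))).trans
      (hf.leftDeriv_le_rightDeriv_of_mem_interior (by simp))
  have hg0 (x : ℝ) : g x ≤ 0 := by
    refine (hle (lt_add_one x)).trans ?_
    rw [add_sub_cancel_left, div_one]
    linarith [hanti (lt_add_one x).le]
  have hgneg (x : ℝ) (hx : x < 0) : g x = -1 := by
    have h1 := hle hx
    have h2 := hge (sub_one_lt x)
    rw [hneg 0 le_rfl, hneg x hx.le, le_div_iff₀ (by linarith)] at h1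
    rw [hneg x hx.le, hneg _ (by linarith), le_iff_lt_or_eq, sub_sub_cancel, div_one] at h2
    rcases h2 with h2 | h2
    · nlinarith
    · linarith
  have hgtop : Tendsto g atTop (𝓝 0) := by
    have h1 : Tendsto (fun x => f x - f (x - 1)) atTop (𝓝 (0 - 0)) :=
      htop.sub (htop.comp (tendsto_atTop_add_const_right _ (-1) tendsto_id))
    rw [sub_zero] at h1
    refine tendsto_of_tendsto_of_tendsto_of_le_of_le h1 tendsto_const_nhds (fun x => ?_) hg0
    have := hge (sub_one_lt x)
    rwa [sub_sub_cancel, div_one] at this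
  -- The right-continuous version of the right derivative; it rises from -1 to 0, so its measure has
  -- mass 1. It equals g wherever g is continuous, that is, off a countable set.
  set H := hmono.stieltjesFunction with hH
  have hHle (x : ℝ) : g x ≤ H x := hmono.le_rightLim le_rfl
  have hHlt {x y : ℝ} (hxy : x < y) : H x ≤ g y := hmono.rightLim_le hxy
  have hHneg (x : ℝ) (hx : x < 0) : H x = -1 := by
    refine le_antisymm ?_ (by rw [← hgneg x hx]; exact hHle x)
    rw [← hgneg (x / 2) (by linarith)]
    exact hHlt (by linarith)
  have hHtop : Tendsto H atTop (𝓝 0) :=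
    tendsto_of_tendsto_of_tendsto_of_le_of_le hgtop tendsto_const_nhds hHle
      fun x => (hHlt (lt_add_one x)).trans (hg0 _)
  have hHbot : Tendsto H atBot (𝓝 (-1)) := by
    refine tendsto_const_nhds.congr' ?_
    filter_upwards [eventually_lt_atBot 0] with x hx
    exact (hHneg x hx).symm
  have hdist : IsDemandDistribution H.measure := by
    refine ⟨⟨by simp [H.measure_univ hHbot hHtop]⟩, ?_⟩
    rw [H.measure_Iio hHbot, ENNReal.ofReal_eq_zero, sub_nonpos]
    refine le_of_tendsto (H.mono.tendsto_leftLim 0) ?_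
    filter_upwards [self_mem_nhdsWithin] with x hx
    exact (hHneg x hx).le
  refine ⟨H.measure, hdist, fun q => ?_⟩
  rw [lintegral_eq_lintegral_meas_lt (f := fun w => max (w - q) 0) _ (ae_of_all _ fun _ => le_max_right _ _) (by fun_prop)]
  have hae : ∀ᵐ t ∂(volume.restrict (Ioi (0 : ℝ))),
      H.measure {w | t < max (w - q) 0} = ENNReal.ofReal (-g (q + t)) := by
    have hc : ∀ᵐ t : ℝ, ContinuousAt g (q + t) := by
      have h := (hmono.countable_not_continuousAt).preimage (add_right_injective q)
      exact h.ae_notMem volume |>.mono fun t ht => not_not.1 ht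
    filter_upwards [ae_restrict_of_ae hc, ae_restrict_mem measurableSet_Ioi] with t ht ht0
    have hset : {w | t < max (w - q) 0} = Ioi (q + t) := by
      ext w
      have : 0 < t := ht0
      simp only [Set.mem_ofPred_eq, lt_max_iff, mem_Ioi]
      constructor
      · rintro (h | h) <;> linarith
      · intro h
        left
        linarith
    have hHg : H (q + t) = g (q + t) := (ht.continuousWithinAt).rightLim_eq
    rw [hset, H.measure_Ioi hHtop, hHg, zero_sub]
  rw [lintegral_congr_ae hae]
  have hmeas : Measurable fun t => -g (q + t) :=
    (hmono.measurable.comp (measurable_const_add q)).neg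
  -- The layer-cake integral of -g is exhausted by bounded intervals, where the fundamental theorem
  -- of calculus gives f q - f (q + n), which tends to f q.
  refine (aecover_Iic (μ := volume.restrict (Ioi (0 : ℝ))) tendsto_natCast_atTop_atTop
    (l := (atTop : Filter ℕ))).lintegral_eq_of_tendsto _ hmeas.ennreal_ofReal.aemeasurable ?_
  have hval (n : ℕ) : ∫⁻ t in Iic (n : ℝ), ENNReal.ofReal (-g (q + t))
      ∂(volume.restrict (Ioi (0 : ℝ))) = ENNReal.ofReal (f q - f (q + n)) := by
    have hii : IntervalIntegrable (fun t => g (q + t)) volume 0 n :=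
      Monotone.intervalIntegrable fun a b hab => hmono (by linarith)
    have hftc : ∫ t in (0 : ℝ)..n, g (q + t) = f (q + n) - f (q + 0) := by
      refine intervalIntegral.integral_eq_sub_of_hasDeriv_right_of_le
        (f := fun t => f (q + t)) (Nat.cast_nonneg n) ?_ (fun x _ => ?_) hii
      · have hcf : Continuous f :=
          continuousOn_univ.1 (hf.continuousOn isOpen_univ)
        fun_prop
      · have h := (hder (q + x)).scomp (h := fun t => q + t) (h' := 1) (s := Ioi x) x
          (((hasDerivAt_id x).const_add q).hasDerivWithinAt)
          (fun t ht => by simpa using ht)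
        simpa [Function.comp_def] using h
    rw [Measure.restrict_restrict measurableSet_Iic, inter_comm, Ioi_inter_Iic,
      ← ofReal_integral_eq_lintegral_ofReal, integral_neg, ← intervalIntegral.integral_of_le
      (Nat.cast_nonneg n), hftc]
    · simp
    · exact ((intervalIntegrable_iff_integrableOn_Ioc_of_le (Nat.cast_nonneg n)).1 hii).neg
    · exact ae_of_all _ fun t => neg_nonneg.2 (hg0 _)
  simp_rw [hval]
  refine (ENNReal.continuous_ofReal.tendsto _).comp ?_
  have h := (htop.comp (tendsto_atTop_add_const_left _ q
    (tendsto_natCast_atTop_atTop (R := ℝ)))).const_sub (f q)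
  simpa [Function.comp_def] using h

/-! ### Regular variation and moments -/

/-- A one-parameter family of linear inequalities, as obtained from convexity of a regularly varying
function, determines a limit. -/
theorem tendsto_of_forall_mul_le {ι : Type*} {l : Filter ι} {s : ι → ℝ} {R : ℝ → ι → ℝ}
    (hR : ∀ t, 0 < t → Tendsto (R t) l (𝓝 (t ^ (1 - α))))
    (h : ∀ t, 0 < t → ∀ᶠ i in l, (1 - t) * s i ≤ R t i - 1) :
    Tendsto s l (𝓝 (α - 1)) := by
  have hd : HasDerivAt (fun t : ℝ => t ^ (1 - α)) (1 - α) 1 := by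
    simpa using Real.hasDerivAt_rpow_const (x := 1) (p := 1 - α) (Or.inl one_ne_zero)
  have hsl := (hasDerivAt_iff_tendsto_slope.1 hd).neg
  rw [neg_sub] at hsl
  have hsl1 : Tendsto _ (𝓝[<] (1 : ℝ)) _ := hsl.mono_left
    (nhdsWithin_mono 1 fun x hx => ne_of_lt hx)
  have hsl2 : Tendsto _ (𝓝[>] (1 : ℝ)) _ := hsl.mono_left
    (nhdsWithin_mono 1 fun x hx => ne_of_gt hx)
  have hpos : ∀ᶠ t : ℝ in 𝓝 1, 0 < t := lt_mem_nhds one_pos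
  refine tendsto_order.2 ⟨fun a ha => ?_, fun a ha => ?_⟩
  -- For t > 1, dividing by 1 - t < 0 turns the inequality into a lower bound for s.
  · obtain ⟨t, hta, ht0, ht1⟩ := ((hsl2.eventually (lt_mem_nhds ha)).and
      ((hpos.filter_mono nhdsWithin_le_nhds).and self_mem_nhdsWithin)).exists
    have ht1' : 0 < t - 1 := sub_pos.2 ht1
    rw [slope_def_field, Real.one_rpow, ← neg_div, lt_div_iff₀ ht1', neg_sub] at hta
    filter_upwards [h t ht0, (hR t ht0).eventually
      (gt_mem_nhds (show t ^ (1 - α) < 1 - a * (t - 1) by linarith))] with i hi hi'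
    nlinarith
  -- For t < 1 it is an upper bound.
  · obtain ⟨t, hta, ht0, ht1⟩ := ((hsl1.eventually (gt_mem_nhds ha)).and
      ((hpos.filter_mono nhdsWithin_le_nhds).and self_mem_nhdsWithin)).exists
    have ht1' : 0 < 1 - t := sub_pos.2 ht1
    rw [slope_def_field, Real.one_rpow, ← neg_div,
      div_lt_iff_of_neg (sub_neg.2 ht1)] at hta
    filter_upwards [h t ht0, (hR t ht0).eventually
      (gt_mem_nhds (show t ^ (1 - α) < 1 + a * (1 - t) by linarith))] with i hi hi'
    nlinarith

theorem isRegularlyVarying_of_tendsto {u : ℝ → ℝ} {ρ c : ℝ} (hc : c ≠ 0)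
    (h : Tendsto (fun x => u x * x ^ (-ρ)) atTop (𝓝 c)) : IsRegularlyVarying u ρ := by
  intro t ht
  have h2 := ((h.comp (tendsto_id.const_mul_atTop ht)).div h hc).mul_const (t ^ ρ)
  rw [div_self hc, one_mul] at h2
  refine h2.congr' ?_
  filter_upwards [eventually_gt_atTop 0] with x hx
  have hx' := (Real.rpow_pos_of_pos hx ρ).ne'
  have ht' := (Real.rpow_pos_of_pos ht ρ).ne'
  simp only [Pi.div_apply, Function.comp_apply, id]
  rw [Real.mul_rpow ht.le hx.le, Real.rpow_neg ht.le, Real.rpow_neg hx.le]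
  field_simp

theorem moment_eq_lintegral_tail (hF : IsDemandDistribution F) {p : ℝ} (hp : 0 < p) :
    moment F p = ENNReal.ofReal p *
      ∫⁻ t in Ioi 0, ENNReal.ofReal (tail F t) * ENNReal.ofReal (t ^ (p - 1)) := by
  have := hF.isProbabilityMeasure
  rw [moment, lintegral_rpow_eq_lintegral_meas_lt_mul F hF.ae_nonneg aemeasurable_id' hp]
  congr 2
  ext t
  rw [tail, ofReal_measureReal]
  rfl

theorem moment_lt_top_of_tendsto (hF : IsDemandDistribution F) {c : ℝ}
    (h : Tendsto (fun x => tail F x * x ^ α) atTop (𝓝 c)) {p : ℝ} (hp : 0 ≤ p) (hpα : p < α) :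
    moment F p < ⊤ := by
  have := hF.isProbabilityMeasure
  rcases hp.eq_or_lt with rfl | hp
  · simp [moment]
  rw [moment_eq_lintegral_tail hF hp]
  refine ENNReal.mul_lt_top ENNReal.ofReal_lt_top ?_
  obtain ⟨M, hM⟩ := eventually_atTop.1 ((h.eventually (gt_mem_nhds (lt_add_one c))))
  set N := max M 1
  have hN : 0 < N := lt_of_lt_of_le one_pos (le_max_right _ _)
  have i1 : IntegrableOn (fun t : ℝ => t ^ (p - 1)) (Ioc 0 N) :=
    (intervalIntegrable_iff_integrableOn_Ioc_of_le hN.le).1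
      (intervalIntegral.intervalIntegrable_rpow' (by linarith))
  have i2 : IntegrableOn (fun t : ℝ => (c + 1) * t ^ (p - 1 - α)) (Ioi N) :=
    (integrableOn_Ioi_rpow_of_lt (by linarith) hN).const_mul _
  rw [← Ioc_union_Ioi_eq_Ioi hN.le, lintegral_union measurableSet_Ioi
    (Ioc_disjoint_Ioi le_rfl)]
  -- Near 0 the tail is at most 1 and p > 0 gives integrability; near infinity the exponent p - 1 -
  -- α is below -1.
  refine ENNReal.add_lt_top.2 ⟨?_, ?_⟩
  · refine (lintegral_mono fun t => ?_).trans_lt i1.lintegral_lt_top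
    refine mul_le_of_le_one_left' (ENNReal.ofReal_le_one.2 measureReal_le_one)
  · refine (setLIntegral_mono' measurableSet_Ioi fun t ht => ?_).trans_lt i2.lintegral_lt_top
    have ht0 : 0 < t := hN.trans ht
    rw [← ENNReal.ofReal_mul (show 0 ≤ tail F t from measureReal_nonneg)]
    refine ENNReal.ofReal_le_ofReal ?_
    have h1 := (hM t ((le_max_left _ _).trans (le_of_lt ht))).le
    have h2 : t ^ (p - 1) = t ^ α * t ^ (p - 1 - α) := by
      rw [← Real.rpow_add ht0]
      congr 1
      ring
    rw [h2, ← mul_assoc]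
    exact mul_le_mul_of_nonneg_right h1 (Real.rpow_pos_of_pos ht0 _).le

theorem moment_eq_top_of_tendsto (hF : IsDemandDistribution F) (hα : 0 < α) {c : ℝ} (hc : 0 < c)
    (h : Tendsto (fun x => tail F x * x ^ α) atTop (𝓝 c)) {p : ℝ} (hpα : α ≤ p) :
    moment F p = ⊤ := by
  rw [moment_eq_lintegral_tail hF (hα.trans_le hpα)]
  refine ENNReal.mul_eq_top.2 (Or.inl ⟨by simpa using hα.trans_le hpα, ?_⟩)
  obtain ⟨M, hM⟩ := eventually_atTop.1 ((h.eventually (lt_mem_nhds (half_lt_self hc))))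
  set N := max M 1
  have hN : 0 < N := lt_of_lt_of_le one_pos (le_max_right _ _)
  have hni : ¬ IntegrableOn (fun t : ℝ => c / 2 * t ^ (p - 1 - α)) (Ioi N) := by
    intro hi
    have hi' := hi.const_mul (c / 2)⁻¹
    simp only [← mul_assoc, inv_mul_cancel₀ (half_pos hc).ne', one_mul] at hi'
    have := (integrableOn_Ioi_rpow_iff hN).1 hi'
    linarith
  have hnn : 0 ≤ᵐ[volume.restrict (Ioi N)] fun t : ℝ => c / 2 * t ^ (p - 1 - α) := by
    filter_upwards [ae_restrict_mem measurableSet_Ioi] with t ht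
    exact mul_nonneg (half_pos hc).le (Real.rpow_nonneg (hN.trans ht).le _)
  have htop : ∫⁻ t in Ioi N, ENNReal.ofReal (c / 2 * t ^ (p - 1 - α)) = ⊤ := by
    by_contra hne
    refine hni ⟨?_, ?_⟩
    · exact (by fun_prop : Measurable fun t : ℝ => c / 2 * t ^ (p - 1 - α)).aestronglyMeasurable
    · exact (hasFiniteIntegral_iff_ofReal hnn).2 (lt_top_iff_ne_top.2 hne)
  rw [← top_le_iff, ← htop]
  refine le_trans (setLIntegral_mono' measurableSet_Ioi fun t ht => ?_)
    (lintegral_mono_set (Ioi_subset_Ioi hN.le))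
  have ht0 : 0 < t := hN.trans ht
  rw [← ENNReal.ofReal_mul (show 0 ≤ tail F t from measureReal_nonneg)]
  refine ENNReal.ofReal_le_ofReal ?_
  have h1 := (hM t ((le_max_left _ _).trans (le_of_lt ht))).le
  have h2 : t ^ (p - 1) = t ^ α * t ^ (p - 1 - α) := by
    rw [← Real.rpow_add ht0]
    congr 1
    ring
  rw [h2, ← mul_assoc]
  exact mul_le_mul_of_nonneg_right h1 (Real.rpow_pos_of_pos ht0 _).le

/-! ### The heavy-tailed distribution -/

theorem exists_expectedShortage_eq (hα : 1 < α) (hm₁ : 0 < m₁) (hmα : m₁ ^ α < mα) :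
    ∃ F : Measure ℝ, IsDemandDistribution F ∧ Integrable (fun w : ℝ => w) F ∧
      ∀ q, expectedShortage F q = worstCaseShortage (ambiguitySet α m₁ mα) q := by
  have hne := ambiguitySet_nonempty hα hm₁ hmα
  obtain ⟨F, hF, hFq⟩ := exists_isDemandDistribution_of_convexOn
    (worstCaseShortage_convexOn hne) (worstCaseShortage_antitone hne)
    (tendsto_worstCaseShortage hα hm₁ hmα) fun q hq => worstCaseShortage_of_nonpos hne hq
  refine ⟨F, hF, ?_, fun q => ?_⟩
  · have h : ∫⁻ w, ENNReal.ofReal w ∂F < ⊤ := by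
      refine lt_of_le_of_lt (lintegral_mono fun w => ENNReal.ofReal_le_ofReal ?_)
        ((hFq 0).trans_lt ENNReal.ofReal_lt_top)
      simp
    exact ⟨measurable_id.aestronglyMeasurable, (hasFiniteIntegral_iff_ofReal hF.ae_nonneg).2 h⟩
  · rw [expectedShortage, integral_eq_lintegral_of_nonneg_ae
      (f := fun w => max (w - q) 0) (ae_of_all _ fun _ => le_max_right _ _)
      (by fun_prop : Measurable fun w : ℝ => max (w - q) 0).aestronglyMeasurable, hFq,
      ENNReal.toReal_ofReal (worstCaseShortage_nonneg q)]

/-- A monotone density argument: W is regularly varying and the tail is minus its derivative, up to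
monotone bounds. -/
theorem tendsto_tail_mul_rpow (hα : 1 < α) (hm₁ : 0 < m₁) (hmα : m₁ ^ α < mα)
    (hF : IsDemandDistribution F) (hi : Integrable (fun w : ℝ => w) F)
    (hFq : ∀ q, expectedShortage F q = worstCaseShortage (ambiguitySet α m₁ mα) q) :
    Tendsto (fun x => tail F x * x ^ α) atTop (𝓝 ((α - 1) * shortageConst α m₁ mα)) := by
  have := hF.isProbabilityMeasure
  have hpos := worstCaseShortage_pos hα hm₁ hmα
  have hs : Tendsto (fun q => q * tail F q / worstCaseShortage (ambiguitySet α m₁ mα) q) atTop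
      (𝓝 (α - 1)) := by
    refine tendsto_of_forall_mul_le (fun t ht => tendsto_worstCaseShortage_ratio hα hm₁ hmα ht)
      fun t ht => ?_
    filter_upwards [eventually_gt_atTop 0] with q hq
    rw [div_sub_one (hpos q).ne', ← mul_div_assoc]
    refine div_le_div_of_nonneg_right ?_ (hpos q).le
    rw [← hFq, ← hFq]
    rcases le_total t 1 with h1 | h1
    · have := tail_mul_le hi (show t * q ≤ q by nlinarith)
      linarith
    · have := le_tail_mul hi (show q ≤ t * q by nlinarith)
      linarith
  refine (hs.mul (tendsto_worstCaseShortage_mul_rpow hα hm₁ hmα)).congr' ?_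
  filter_upwards [eventually_gt_atTop 0] with q hq
  have := (hpos q).ne'
  have e : q ^ α = q ^ (α - 1) * q := by rw [← Real.rpow_add_one hq.ne', sub_add_cancel]
  rw [e]
  field_simp

theorem exists_isHeavyTailedEquivalent (hα : 1 < α) (hm₁ : 0 < m₁) (hmα : m₁ ^ α < mα) :
    ∃ F : Measure ℝ, IsHeavyTailedEquivalent α m₁ mα F := by
  obtain ⟨F, hF, hi, hFq⟩ := exists_expectedShortage_eq hα hm₁ hmα
  have ht := tendsto_tail_mul_rpow hα hm₁ hmα hF hi hFq
  have hc : 0 < (α - 1) * shortageConst α m₁ mα :=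
    mul_pos (by linarith) (shortageConst_pos hα hmα)
  have htop (p : ℝ) (hp : α ≤ p) : moment F p = ⊤ :=
    moment_eq_top_of_tendsto hF (by linarith) hc ht hp
  refine ⟨F, hF, fun hmem => ?_, fun q _ => hFq q,
    isRegularlyVarying_of_tendsto hc.ne' (by simpa using ht),
    fun p hp hpα => moment_lt_top_of_tendsto hF ht hp hpα, htop⟩
  -- Membership would make the α-moment finite.
  have h := hmem.2.2.1.lintegral_lt_top
  exact h.ne (htop α le_rfl)

/-! ### Optimal order quantities -/

theorem IsHeavyTailedEquivalent.isOptimal (hF : IsHeavyTailedEquivalent α m₁ mα F) {η q : ℝ}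
    (hq : IsRobustOptimal (ambiguitySet α m₁ mα) η q) : IsOptimal F η q := by
  refine ⟨hq.1, fun r hr => ?_⟩
  have h : robustCost (ambiguitySet α m₁ mα) η q ≤ robustCost (ambiguitySet α m₁ mα) η r := hq.2 hr
  have e (r : ℝ) (hr : r ∈ Ici (0 : ℝ)) : cost F η r = robustCost (ambiguitySet α m₁ mα) η r := by
    rw [cost, hF.shortage_eq r hr, robustCost]
  rw [← e q hq.1, ← e r hr] at h
  exact h

theorem exists_isRobustOptimal (hne : (ambiguitySet α m₁ mα).Nonempty) {η : ℝ} (hη : η < 1) :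
    ∃ q, IsRobustOptimal (ambiguitySet α m₁ mα) η q := by
  set W := worstCaseShortage (ambiguitySet α m₁ mα) with hW
  have hη' : 0 < 1 - η := by linarith
  have hcont : Continuous W :=
    continuousOn_univ.1 ((worstCaseShortage_convexOn hne).continuousOn isOpen_univ)
  have hC : Continuous (robustCost (ambiguitySet α m₁ mα) η) :=
    (continuous_const.mul continuous_id).add hcont
  have h0 : 0 ≤ W 0 / (1 - η) := div_nonneg (worstCaseShortage_nonneg 0) hη'.le
  -- Beyond W 0 / (1 - η) the ordering cost alone exceeds the whole cost at 0.
  obtain ⟨q, hq, hmin⟩ := (isCompact_Icc (a := 0) (b := W 0 / (1 - η))).exists_isMinOn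
    (nonempty_Icc.2 h0) hC.continuousOn
  refine ⟨q, hq.1, fun r hr => ?_⟩
  rcases le_or_gt r (W 0 / (1 - η)) with h | h
  · exact hmin ⟨hr, h⟩
  · have h1 : robustCost (ambiguitySet α m₁ mα) η q ≤ robustCost (ambiguitySet α m₁ mα) η 0 :=
      hmin ⟨le_rfl, h0⟩
    refine h1.trans ?_
    rw [div_lt_iff₀ hη'] at h
    have h2 : 0 ≤ W r := worstCaseShortage_nonneg r
    simp only [robustCost, mul_zero, zero_add]
    linarith

theorem IsRobustOptimal.optimalRobustCost_eq {𝓕 : Set (Measure ℝ)} {η q : ℝ}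
    (hq : IsRobustOptimal 𝓕 η q) : optimalRobustCost 𝓕 η = robustCost 𝓕 η q :=
  IsLeast.csInf_eq ⟨mem_image_of_mem _ hq.1, by rintro _ ⟨r, hr, rfl⟩; exact hq.2 hr⟩

/-- An order below M costs at least W(M) > 0, whereas a fixed large r has W(r) < W(M) and a cost
tending to W(r) as η ↑ 1. -/
theorem tendsto_isRobustOptimal (hα : 1 < α) (hm₁ : 0 < m₁) (hmα : m₁ ^ α < mα) {q : ℝ → ℝ}
    (hq : ∀ᶠ η in 𝓝[<] 1, IsRobustOptimal (ambiguitySet α m₁ mα) η (q η)) :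
    Tendsto q (𝓝[<] 1) atTop := by
  refine tendsto_atTop.2 fun M => ?_
  have hM := worstCaseShortage_pos hα hm₁ hmα M
  obtain ⟨r, hr, hr0⟩ := (((tendsto_worstCaseShortage hα hm₁ hmα).eventually
    (gt_mem_nhds hM)).and (eventually_ge_atTop 0)).exists
  have ht : Tendsto (fun η : ℝ => robustCost (ambiguitySet α m₁ mα) η r) (𝓝[<] 1)
      (𝓝 (robustCost (ambiguitySet α m₁ mα) 1 r)) := by
    have : Continuous fun η : ℝ => robustCost (ambiguitySet α m₁ mα) η r := by
      unfold robustCost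
      fun_prop
    exact (this.tendsto 1).mono_left nhdsWithin_le_nhds
  filter_upwards [hq, self_mem_nhdsWithin, ht.eventually (gt_mem_nhds (show _ < _ by
    simpa [robustCost] using hr))] with η hη hη1 hlt
  by_contra! hlt'
  have h1 : robustCost (ambiguitySet α m₁ mα) η (q η) ≤
    robustCost (ambiguitySet α m₁ mα) η r := hη.2 hr0
  have h2 := worstCaseShortage_antitone (ambiguitySet_nonempty hα hm₁ hmα) hlt'.le
  have h3 : 0 ≤ (1 - η) * q η := mul_nonneg (sub_nonneg.2 (le_of_lt hη1)) hη.1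
  have h4 : robustCost (ambiguitySet α m₁ mα) η (q η) =
    (1 - η) * q η + worstCaseShortage (ambiguitySet α m₁ mα) (q η) := rfl
  linarith

theorem isEquivalent_optimalRobustCost (hα : 1 < α) (hm₁ : 0 < m₁) (hmα : m₁ ^ α < mα) {q : ℝ → ℝ}
    (hq : ∀ᶠ η in 𝓝[<] 1, IsRobustOptimal (ambiguitySet α m₁ mα) η (q η)) :
    q ~[𝓝[<] 1] fun η => (α - 1) / α * (1 / (1 - η)) *
      optimalRobustCost (ambiguitySet α m₁ mα) η := by
  have hα1 : 0 < α - 1 := by linarith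
  have hqt := tendsto_isRobustOptimal hα hm₁ hmα hq
  set W := worstCaseShortage (ambiguitySet α m₁ mα) with hW
  have hpos : ∀ r, 0 < W r := worstCaseShortage_pos hα hm₁ hmα
  have hs : Tendsto (fun η => (1 - η) * q η / W (q η)) (𝓝[<] 1) (𝓝 (α - 1)) := by
    refine tendsto_of_forall_mul_le
      (fun t ht => (tendsto_worstCaseShortage_ratio hα hm₁ hmα ht).comp hqt) fun t ht => ?_
    filter_upwards [hq] with η hη
    -- Optimality tested against the rescaled order t q.
    have h : (1 - η) * q η + W (q η) ≤ (1 - η) * (t * q η) + W (t * q η) :=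
      hη.2 (mul_nonneg ht.le hη.1)
    simp only [Function.comp_apply]
    rw [div_sub_one (hpos _).ne', ← mul_div_assoc]
    exact div_le_div_of_nonneg_right (by linarith) (hpos _).le
  have hlim : Tendsto (fun η => α / (α - 1) * ((1 - η) * q η / W (q η) /
      ((1 - η) * q η / W (q η) + 1))) (𝓝[<] 1) (𝓝 1) := by
    have h := (hs.div (hs.add_const 1) (by linarith)).const_mul (α / (α - 1))
    rwa [sub_add_cancel, div_mul_div_cancel₀ hα1.ne', div_self (by linarith)] at h
  refine isEquivalent_of_tendsto_one (hlim.congr' ?_)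
  filter_upwards [hq, self_mem_nhdsWithin, hqt.eventually (eventually_gt_atTop 0)] with η hη hη1 hq0
  have hη' : 0 < 1 - η := sub_pos.2 hη1
  have hw := hpos (q η)
  have hC : 0 < (1 - η) * q η + W (q η) := by positivity
  rw [Pi.div_apply, hη.optimalRobustCost_eq, robustCost, ← hW]
  have := hC.ne'
  rw [div_add_one hw.ne']
  field_simp

end Newsvendor

theorem proposition5 (α m₁ mα : ℝ) (hα : 1 < α) (hm₁ : 0 < m₁) (hmα : m₁ ^ α < mα) :
    (∃ Fstar : Measure ℝ, Newsvendor.IsHeavyTailedEquivalent α m₁ mα Fstar) ∧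
    (∀ Fstar : Measure ℝ, Newsvendor.IsHeavyTailedEquivalent α m₁ mα Fstar →
      ∀ η ∈ Ioo (0 : ℝ) 1, ∀ q : ℝ,
        Newsvendor.IsRobustOptimal (Newsvendor.ambiguitySet α m₁ mα) η q →
        Newsvendor.IsOptimal Fstar η q) ∧
    (∀ η ∈ Ioo (0 : ℝ) 1, ∃ q : ℝ,
      Newsvendor.IsRobustOptimal (Newsvendor.ambiguitySet α m₁ mα) η q) ∧
    (∀ q : ℝ → ℝ,
      (∀ η ∈ Ioo (0 : ℝ) 1,
        Newsvendor.IsRobustOptimal (Newsvendor.ambiguitySet α m₁ mα) η (q η)) →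
      q ~[𝓝[<] 1] fun η => (α - 1) / α * (1 / (1 - η)) *
        Newsvendor.optimalRobustCost (Newsvendor.ambiguitySet α m₁ mα) η) := by
  have hev {P : ℝ → Prop} (h : ∀ η ∈ Ioo (0 : ℝ) 1, P η) : ∀ᶠ η in 𝓝[<] 1, P η :=
    eventually_of_mem (Ioo_mem_nhdsLT one_pos) h
  exact ⟨Newsvendor.exists_isHeavyTailedEquivalent hα hm₁ hmα,
    fun _ hF _ _ _ hq => hF.isOptimal hq,
    fun _ hη => Newsvendor.exists_isRobustOptimal
      (Newsvendor.ambiguitySet_nonempty hα hm₁ hmα) hη.2,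
    fun _ hq => Newsvendor.isEquivalent_optimalRobustCost hα hm₁ hmα (hev hq)⟩
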